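/- Let $G$ be a finite abelian group of order $N$ (written additively), let $n\ge 0$, $k\ge 1$ and $\lambda\ge 1$ be integers, and let $y\in G$. Let $x_1,\dots,x_n$ be independent random elements of $G$, each uniformly distributed on $G$, and let $$Y=\Bigl|\Bigl\{I\subseteq\{1,\dots,n\} : |I|=k,\ \sum_{i\in I}x_i=y\Bigr\}\Bigr|.$$ Assume that $\lambda\ge 2\log_2 N$, that $$\binom{n}{k}\ \ge\ 800\,(\ln 2)\,k\,N\,\lambda^{2k+1},\qquad\text{and that}\qquad \binom{n}{k-1}\ \le\ \frac{\lambda N}{k\,2^{k}}.$$ Then $$\Pr\Bigl[\,\bigl|Y-\mathbb{E}[Y]\bigr|>\tfrac15\,\mathbb{E}[Y]\Bigr]\ <\ 5\cdot 2^{-\lambda}.$$ -/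

import Mathlib

open MeasureTheory ProbabilityTheory

/-- The family of all `k`-element index sets `I ⊆ [n]` with `∑ i ∈ I, x i = y`. -/
noncomputable def subsetSumFamily {G : Type*} [AddCommGroup G] {n : ℕ} (k : ℕ) (y : G)
    (x : Fin n → G) : Finset (Finset (Fin n)) :=
  by classical exact {I ∈ Finset.powersetCard k Finset.univ | ∑ i ∈ I, x i = y}

/-- The number of `k`-element index sets `I ⊆ [n]` with `∑ i ∈ I, x i = y`, as a real number. -/
noncomputable def subsetSumCount {G : Type*} [AddCommGroup G] {n : ℕ} (k : ℕ) (y : G)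
    (x : Fin n → G) : ℝ :=
  ((subsetSumFamily k y x).card : ℝ)

/-- `x 0, …, x (n - 1)` are independent random elements of the finite type `G`, each of them
uniformly distributed on `G`. -/
structure IsIIDUniform {Ω G : Type*} [MeasurableSpace Ω] [MeasurableSpace G] {n : ℕ}
    (P : Measure Ω) (x : Fin n → Ω → G) : Prop where
  measurable : ∀ i, Measurable (x i)
  indep : iIndepFun x P
  uniform : ∀ i, P.map (x i) = uniformOn (Set.univ : Set G)

/-! For distinct `k`-sets `I`, `J` the events that `I` and `J` sum to `y` are independent, each of
probability `1/N`, so the mean is `n.choose k / N` and the second moment is small. Pairwise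
independence alone gives no exponential tail; the two tails need different devices.

Lower tail (`unifProb_hitCount_lower`): the count is, up to scaling, the average over permutations
of the index set of the solutions lying inside `m` disjoint blocks. For one permutation the block
counts are independent, and the second moment bounds each Laplace transform; Jensen passes this to
the average.

Upper tail (`unifProb_le_of_hitCount_large`): the expected number of `r`-tuples of disjoint
solutions is at most the mean to the power `r`. If few solutions pass through any index, a count
above `b` by a suitable margin forces at least `b ^ r` such tuples, and Markov applies. Solutions
through `i` are solutions of size `k - 1` for the target `y - a i`, so the degree condition is
proved by the same tuple argument, inductively in the set size and for all targets at once
(`unifProb_exists_hitCount_gt_le`).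

The two binomial hypotheses make the lower tail, the degree failure and the upper tail at most
`2^(-l)` each. -/

open Finset
open scoped BigOperators

/-! ### Uniform probability on a finite type -/

section UniformProbability

variable {α : Type*} [Fintype α]

/-- The probability of `s` under the uniform distribution on a finite type. -/
noncomputable def unifProb (s : Set α) : ℝ := 𝔼 a, s.indicator (fun _ => (1 : ℝ)) a

theorem unifProb_mono {s t : Set α} (h : s ⊆ t) : unifProb s ≤ unifProb t :=
  expect_le_expect fun a _ => Set.indicator_le_indicator_of_subset h (fun _ => zero_le_one) a

theorem unifProb_union_le (s t : Set α) : unifProb (s ∪ t) ≤ unifProb s + unifProb t := by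
  rw [unifProb, unifProb, unifProb, ← expect_add_distrib]
  refine expect_le_expect fun a _ => ?_
  by_cases hs : a ∈ s <;> by_cases ht : a ∈ t <;> simp [hs, ht]

theorem unifProb_empty : unifProb (∅ : Set α) = 0 := by simp [unifProb]

theorem unifProb_iUnion_le {β : Type*} [Fintype β] (s : β → Set α) {c : ℝ}
    (h : ∀ b, unifProb (s b) ≤ c) : unifProb (⋃ b, s b) ≤ Fintype.card β * c := by
  have key : ∀ t : Finset β, unifProb (⋃ b ∈ t, s b) ≤ t.card * c := by
    classical
    intro t
    induction t using Finset.induction_on with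
    | empty => simp [unifProb_empty]
    | insert b t hb ih =>
      rw [Finset.set_biUnion_insert, card_insert_of_notMem hb]
      have := unifProb_union_le (s b) (⋃ x ∈ t, s x)
      push_cast
      linarith [h b]
  simpa using key univ

/-- Markov's inequality. -/
theorem unifProb_le_of_le {s : Set α} {f : α → ℝ} {c : ℝ} (hc : 0 < c) (hf : ∀ a, 0 ≤ f a)
    (h : ∀ a ∈ s, c ≤ f a) : unifProb s ≤ (𝔼 a, f a) / c := by
  rw [unifProb, expect_div]
  refine expect_le_expect fun a _ => ?_
  by_cases ha : a ∈ s
  · simpa [ha, le_div_iff₀ hc] using h a ha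
  · simpa [ha] using div_nonneg (hf a) hc.le

end UniformProbability

/-! ### Solution counts: first and second moments -/

section Counting

variable {ι G : Type*} [AddCommGroup G]

/-- The indicator of the event `∑ i ∈ I, a i = y`. -/
noncomputable def hitIndicator (I : Finset ι) (y : G) (a : ι → G) : ℝ :=
  Set.indicator {z | z = y} (fun _ => (1 : ℝ)) (∑ i ∈ I, a i)

/-- The number of `k`-element subsets of `B` over which `a` sums to `y`. -/
noncomputable def hitCount (B : Finset ι) (k : ℕ) (y : G) (a : ι → G) : ℝ :=
  ∑ I ∈ B.powersetCard k, hitIndicator I y a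

theorem hitIndicator_of_eq {I : Finset ι} {y : G} {a : ι → G} (h : ∑ i ∈ I, a i = y) :
    hitIndicator I y a = 1 := by simp [hitIndicator, h]

theorem hitIndicator_of_ne {I : Finset ι} {y : G} {a : ι → G} (h : ∑ i ∈ I, a i ≠ y) :
    hitIndicator I y a = 0 := by simp [hitIndicator, h]

theorem hitIndicator_nonneg (I : Finset ι) (y : G) (a : ι → G) : 0 ≤ hitIndicator I y a :=
  Set.indicator_nonneg (fun _ _ => zero_le_one) _

theorem hitIndicator_le_one (I : Finset ι) (y : G) (a : ι → G) : hitIndicator I y a ≤ 1 := by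
  by_cases h : ∑ i ∈ I, a i = y
  · exact (hitIndicator_of_eq h).le
  · exact (hitIndicator_of_ne h).le.trans zero_le_one

theorem hitIndicator_mul_self (I : Finset ι) (y : G) (a : ι → G) :
    hitIndicator I y a * hitIndicator I y a = hitIndicator I y a := by
  by_cases h : ∑ i ∈ I, a i = y
  · simp [hitIndicator_of_eq h]
  · simp [hitIndicator_of_ne h]

theorem hitIndicator_congr {I : Finset ι} {a b : ι → G} (h : ∀ i ∈ I, a i = b i) (y : G) :
    hitIndicator I y a = hitIndicator I y b := by
  rw [hitIndicator, hitIndicator, sum_congr rfl h]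

theorem hitCount_nonneg (B : Finset ι) (k : ℕ) (y : G) (a : ι → G) : 0 ≤ hitCount B k y a :=
  sum_nonneg fun _ _ => hitIndicator_nonneg _ _ _

theorem hitCount_congr {B : Finset ι} {a b : ι → G} (h : ∀ i ∈ B, a i = b i) (k : ℕ) (y : G) :
    hitCount B k y a = hitCount B k y b :=
  sum_congr rfl fun _ hI =>
    hitIndicator_congr (fun i hi => h i ((mem_powersetCard.1 hI).1 hi)) y

theorem hitCount_zero_le_one (B : Finset ι) (y : G) (a : ι → G) : hitCount B 0 y a ≤ 1 := by
  simpa [hitCount] using hitIndicator_le_one ∅ y a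

variable [DecidableEq ι]

theorem hitIndicator_add_single {I : Finset ι} {i : ι} (hi : i ∈ I) (y : G) (a : ι → G) (g : G) :
    hitIndicator I y (a + Pi.single i g) = hitIndicator I (y - g) a := by
  have : ∑ j ∈ I, (a + Pi.single i g : ι → G) j = ∑ j ∈ I, a j + g := by
    simp [Pi.add_apply, sum_add_distrib, hi]
  by_cases h : ∑ j ∈ I, a j = y - g
  · rw [hitIndicator_of_eq h, hitIndicator_of_eq (by rw [this, h]; abel)]
  · rw [hitIndicator_of_ne h, hitIndicator_of_ne]
    rw [this]
    exact fun h' => h (eq_sub_of_add_eq h')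

theorem hitIndicator_add_single_of_notMem {I : Finset ι} {i : ι} (hi : i ∉ I) (y : G) (a : ι → G)
    (g : G) : hitIndicator I y (a + Pi.single i g) = hitIndicator I y a :=
  hitIndicator_congr (fun j hj => by
    have : j ≠ i := fun h => hi (h ▸ hj)
    simp [this]) y

variable [Fintype ι] [Fintype G]

/-- Translating coordinate `i` by `g` preserves the uniform law and `F` but moves the target to `y -
g`; averaging over `g`, exactly one target is hit. -/
theorem expect_hitIndicator_mul {I : Finset ι} {i : ι} (hi : i ∈ I) (y : G) {F : (ι → G) → ℝ}
    (hF : ∀ a g, F (a + Pi.single i g) = F a) :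
    𝔼 a, hitIndicator I y a * F a = (𝔼 a, F a) / Fintype.card G := by
  have shift : ∀ g, 𝔼 a, hitIndicator I y a * F a = 𝔼 a, hitIndicator I (y - g) a * F a := by
    intro g
    refine (Fintype.expect_equiv (Equiv.addRight (Pi.single i g)) _ _ fun a => ?_).symm
    rw [Equiv.coe_addRight, hitIndicator_add_single hi, hF]
  have total : ∀ a : ι → G, 𝔼 g, hitIndicator I (y - g) a = 1 / Fintype.card G := by
    intro a
    rw [Fintype.expect_eq_sum_div_card, Fintype.sum_eq_single (y - ∑ j ∈ I, a j)]
    · rw [hitIndicator_of_eq (by abel)]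
    · intro g hg
      exact hitIndicator_of_ne fun h => hg (by rw [h]; abel)
  calc 𝔼 a, hitIndicator I y a * F a
      = 𝔼 _g : G, 𝔼 a, hitIndicator I y a * F a := (expect_const univ_nonempty _).symm
    _ = 𝔼 g : G, 𝔼 a, hitIndicator I (y - g) a * F a := expect_congr rfl fun g _ => shift g
    _ = 𝔼 a, 𝔼 g : G, hitIndicator I (y - g) a * F a := expect_comm _ _ _
    _ = (𝔼 a, F a) / Fintype.card G := by
      rw [expect_div]
      refine expect_congr rfl fun a _ => ?_
      rw [← expect_mul, total]
      ring

theorem expect_hitIndicator {I : Finset ι} (hI : I.Nonempty) (y : G) :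
    𝔼 a, hitIndicator I y a = 1 / Fintype.card G := by
  obtain ⟨i, hi⟩ := hI
  simpa using expect_hitIndicator_mul hi y (F := fun _ => 1) fun _ _ => rfl

theorem expect_hitCount (B : Finset ι) {k : ℕ} (hk : 1 ≤ k) (y : G) :
    𝔼 a, hitCount B k y a = B.card.choose k / Fintype.card G := by
  simp only [hitCount]
  rw [expect_sum_comm, sum_congr rfl fun I hI => expect_hitIndicator (card_pos.1 (by
    rw [(mem_powersetCard.1 hI).2]; omega)) y]
  simp [div_eq_mul_inv]

theorem expect_hitIndicator_mul_hitIndicator {I J : Finset ι} (hIJ : I ≠ J)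
    (hc : I.card = J.card) (hI : I.Nonempty) (y : G) :
    𝔼 a, hitIndicator I y a * hitIndicator J y a
      = 1 / Fintype.card G * (1 / Fintype.card G) := by
  obtain ⟨i, hi, hiJ⟩ : ∃ i ∈ I, i ∉ J := by
    by_contra! h
    exact hIJ (eq_of_subset_of_card_le h hc.ge)
  rw [expect_hitIndicator_mul hi y fun a g => hitIndicator_add_single_of_notMem hiJ y a g,
    expect_hitIndicator (card_pos.1 (hc ▸ card_pos.2 hI))]
  ring

theorem expect_hitCount_sq_le (B : Finset ι) {k : ℕ} (hk : 1 ≤ k) (y : G) :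
    𝔼 a, hitCount B k y a ^ 2 ≤ (B.card.choose k / Fintype.card G : ℝ)
      + (B.card.choose k / Fintype.card G : ℝ) ^ 2 := by
  have hne : ∀ I ∈ B.powersetCard k, I.Nonempty := fun I hI => card_pos.1 (by
    rw [(mem_powersetCard.1 hI).2]; omega)
  set p : ℝ := 1 / Fintype.card G with hp
  have hp0 : 0 ≤ p := by positivity
  have h : ∀ I ∈ B.powersetCard k, ∀ J ∈ B.powersetCard k,
      𝔼 a, hitIndicator I y a * hitIndicator J y a ≤ (if I = J then p else 0) + p * p := by
    intro I hI J hJ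
    split_ifs with hIJ
    · subst hIJ
      simp only [hitIndicator_mul_self, expect_hitIndicator (hne I hI)]
      nlinarith
    · rw [expect_hitIndicator_mul_hitIndicator hIJ _ (hne I hI), zero_add]
      rw [(mem_powersetCard.1 hI).2, (mem_powersetCard.1 hJ).2]
  calc 𝔼 a, hitCount B k y a ^ 2
      = ∑ I ∈ B.powersetCard k, ∑ J ∈ B.powersetCard k,
          𝔼 a, hitIndicator I y a * hitIndicator J y a := by
        simp only [hitCount, sq, sum_mul_sum]
        rw [expect_sum_comm]
        exact sum_congr rfl fun I _ => expect_sum_comm _ _ _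
    _ ≤ ∑ I ∈ B.powersetCard k, ∑ J ∈ B.powersetCard k, ((if I = J then p else 0) + p * p) :=
        sum_le_sum fun I hI => sum_le_sum fun J hJ => h I hI J hJ
    _ = _ := by
        simp only [sum_add_distrib, sum_const, card_powersetCard, nsmul_eq_mul, sum_ite_eq]
        rw [sum_congr rfl fun I hI => if_pos hI]
        simp only [sum_const, card_powersetCard, nsmul_eq_mul, hp]
        ring

end Counting

/-! ### Upper tail by counting disjoint tuples of solutions -/

section Tuples

variable {ι G : Type*} [AddCommGroup G] [Fintype ι] [DecidableEq ι]

/-- The number of `r`-tuples of `k`-element sets that are disjoint from `S` and from each other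
and over each of which `a` sums to `y`. -/
noncomputable def disjointTuples (k : ℕ) (y : G) (a : ι → G) : ℕ → Finset ι → ℝ
  | 0, _ => 1
  | r + 1, S => ∑ I ∈ Sᶜ.powersetCard k, hitIndicator I y a * disjointTuples k y a r (S ∪ I)

theorem disjointTuples_nonneg (k : ℕ) (y : G) (a : ι → G) (r : ℕ) (S : Finset ι) :
    0 ≤ disjointTuples k y a r S := by
  induction r generalizing S with
  | zero => exact zero_le_one
  | succ r ih => exact sum_nonneg fun I _ => mul_nonneg (hitIndicator_nonneg _ _ _) (ih _)

theorem disjointTuples_congr (k : ℕ) (y : G) {a b : ι → G} (r : ℕ) {S : Finset ι}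
    (h : ∀ i ∉ S, a i = b i) : disjointTuples k y a r S = disjointTuples k y b r S := by
  induction r generalizing S with
  | zero => rfl
  | succ r ih =>
    refine sum_congr rfl fun I hI => ?_
    rw [ih fun i hi => h i fun hS => hi (mem_union_left _ hS),
      hitIndicator_congr fun i hi => h i (mem_compl.1 ((mem_powersetCard.1 hI).1 hi))]

/-- The later sets of a tuple avoid `I`, so the remaining count ignores the coordinates in `I`, and
each set contributes a factor `1/N`. -/
theorem expect_disjointTuples_le [Fintype G] {k : ℕ} (hk : 1 ≤ k) (y : G) (r : ℕ)
    (S : Finset ι) :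
    𝔼 a, disjointTuples k y a r S
      ≤ ((Fintype.card ι).choose k / Fintype.card G : ℝ) ^ r := by
  induction r generalizing S with
  | zero => simp [disjointTuples]
  | succ r ih =>
    simp only [disjointTuples]
    rw [expect_sum_comm]
    set c : ℝ := ((Fintype.card ι).choose k / Fintype.card G : ℝ) with hc
    have hterm : ∀ I ∈ Sᶜ.powersetCard k,
        𝔼 a, hitIndicator I y a * disjointTuples k y a r (S ∪ I) ≤ c ^ r / Fintype.card G := by
      intro I hI
      obtain ⟨i, hi⟩ : I.Nonempty := card_pos.1 (by rw [(mem_powersetCard.1 hI).2]; omega)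
      rw [expect_hitIndicator_mul hi]
      · exact div_le_div_of_nonneg_right (ih _) (Nat.cast_nonneg _)
      · intro a g
        refine disjointTuples_congr _ _ _ fun j hj => ?_
        have : j ≠ i := fun h => hj (mem_union_right _ (h ▸ hi))
        simp [this]
    refine (sum_le_sum hterm).trans ?_
    rw [sum_const, card_powersetCard, nsmul_eq_mul, pow_succ, mul_div_assoc']
    have : ((Sᶜ.card.choose k : ℕ) : ℝ) ≤ (Fintype.card ι).choose k := by
      exact_mod_cast Nat.choose_le_choose k (card_le_univ _)
    have hc0 : 0 ≤ c := by positivity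
    calc _ ≤ ((Fintype.card ι).choose k : ℝ) * c ^ r / Fintype.card G := by gcongr
      _ = _ := by rw [hc]; ring

theorem sum_hitIndicator_mem_le (k : ℕ) (y : G) (a : ι → G) (i : ι) :
    ∑ I ∈ (univ : Finset ι).powersetCard k with i ∈ I, hitIndicator I y a
      ≤ hitCount univ (k - 1) (y - a i) a := by
  have hinj : Set.InjOn (fun I : Finset ι => I.erase i)
      ((univ.powersetCard k).filter (i ∈ ·) : Finset (Finset ι)) := by
    intro I hI J hJ h
    have hI' := (mem_filter.1 hI).2
    have hJ' := (mem_filter.1 hJ).2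
    rw [← insert_erase hI', ← insert_erase hJ']
    exact congrArg _ h
  have heq : ∑ I ∈ (univ : Finset ι).powersetCard k with i ∈ I, hitIndicator I y a
      = ∑ J ∈ ((univ.powersetCard k).filter (i ∈ ·)).image (fun I : Finset ι => I.erase i),
          hitIndicator J (y - a i) a := by
    rw [sum_image hinj]
    refine sum_congr rfl fun I hI => ?_
    have hI' := (mem_filter.1 hI).2
    have hs := add_sum_erase I a hI'
    by_cases h : ∑ j ∈ I, a j = y
    · rw [hitIndicator_of_eq h, hitIndicator_of_eq]
      rw [← h, ← hs]; abel
    · rw [hitIndicator_of_ne h, hitIndicator_of_ne]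
      intro h'
      exact h (by rw [← hs, h']; abel)
  rw [heq]
  refine sum_le_sum_of_subset_of_nonneg (fun J hJ => ?_) fun _ _ _ => hitIndicator_nonneg _ _ _
  obtain ⟨I, hI, rfl⟩ := mem_image.1 hJ
  obtain ⟨hI, hi⟩ := mem_filter.1 hI
  rw [mem_powersetCard]
  exact ⟨subset_univ _, by rw [card_erase_of_mem hi, (mem_powersetCard.1 hI).2]⟩

/-- A solution not inside `Sᶜ` passes through some `i ∈ S`, and at most `d` of them pass through
each `i`. -/
theorem hitCount_le_hitCount_compl_add {k : ℕ} (y : G) (a : ι → G) {d : ℝ}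
    (hd : ∀ z, hitCount univ (k - 1) z a ≤ d) (S : Finset ι) :
    hitCount univ k y a ≤ hitCount Sᶜ k y a + S.card * d := by
  have hsplit : ∀ I ∈ (univ : Finset ι).powersetCard k, hitIndicator I y a
      ≤ (if I ⊆ Sᶜ then hitIndicator I y a else 0)
        + ∑ i ∈ S, if i ∈ I then hitIndicator I y a else 0 := by
    intro I _
    have h0 := hitIndicator_nonneg I y a
    have hn : ∀ i ∈ S, 0 ≤ if i ∈ I then hitIndicator I y a else 0 := by
      intro i _
      split_ifs <;> simp [h0]
    split_ifs with h
    · linarith [sum_nonneg hn]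
    · obtain ⟨i, hi, hiS⟩ := not_subset.1 h
      have := single_le_sum hn (by simpa using hiS : i ∈ S)
      rw [if_pos hi] at this
      linarith
  refine (sum_le_sum hsplit).trans ?_
  rw [sum_add_distrib, sum_comm]
  gcongr ?_ + ?_
  · rw [← sum_filter, hitCount]
    refine (sum_subset_zero_on_sdiff ?_ ?_ fun _ _ => rfl).le
    · intro I hI
      simp only [mem_filter, mem_powersetCard, subset_univ, true_and] at hI ⊢
      exact ⟨hI.2, hI.1⟩
    · intro I hI
      simp only [mem_sdiff, mem_filter, mem_powersetCard, subset_univ, true_and] at hI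
      exact absurd ⟨hI.1.2, hI.1.1⟩ hI.2
  · rw [← nsmul_eq_mul]
    refine sum_le_card_nsmul _ _ _ fun i _ => ?_
    rw [← sum_filter]
    exact (sum_hitIndicator_mem_le k y a i).trans (hd _)

/-- Greedy choice: the indices already used destroy at most `d` solutions each, so at every stage at
least `b` choices remain. -/
theorem pow_le_disjointTuples {k : ℕ} (y : G) (a : ι → G) {d b : ℝ} (hb : 0 ≤ b)
    (hd0 : 0 ≤ d) (hd : ∀ z, hitCount univ (k - 1) z a ≤ d) (r : ℕ) (S : Finset ι)
    (h : b + (S.card + r * k) * d ≤ hitCount univ k y a) :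
    b ^ r ≤ disjointTuples k y a r S := by
  induction r generalizing S with
  | zero => simp [disjointTuples]
  | succ r ih =>
    have hlow := hitCount_le_hitCount_compl_add y a hd S
    have hkr : (0 : ℝ) ≤ (r + 1) * k * d := by positivity
    push_cast at h
    calc b ^ (r + 1) = b * b ^ r := pow_succ' _ _
      _ ≤ hitCount Sᶜ k y a * b ^ r := by
        gcongr
        nlinarith
      _ ≤ disjointTuples k y a (r + 1) S := by
        rw [hitCount, sum_mul, disjointTuples]
        refine sum_le_sum fun I hI => ?_
        refine mul_le_mul_of_nonneg_left (ih _ (le_trans ?_ h)) (hitIndicator_nonneg _ _ _)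
        have hcard : ((S ∪ I).card : ℝ) ≤ S.card + k := by
          exact_mod_cast (card_union_le _ _).trans_eq (by rw [(mem_powersetCard.1 hI).2])
        have := mul_le_mul_of_nonneg_right hcard hd0
        linarith

theorem unifProb_le_of_hitCount_large [Fintype G] {k : ℕ} (hk : 1 ≤ k) (y : G) {d b : ℝ}
    (hb : 0 < b) (hd0 : 0 ≤ d) (r : ℕ) :
    unifProb {a : ι → G | (∀ z, hitCount univ (k - 1) z a ≤ d) ∧
        b + r * k * d ≤ hitCount univ k y a}
      ≤ ((Fintype.card ι).choose k / Fintype.card G / b : ℝ) ^ r := by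
  refine (unifProb_le_of_le (pow_pos hb r) (f := fun a => disjointTuples k y a r ∅)
    (fun a => disjointTuples_nonneg _ _ _ _ _) ?_).trans ?_
  · rintro a ⟨hd, h⟩
    exact pow_le_disjointTuples y a hb.le hd0 hd r ∅ (by simpa using h)
  · rw [div_pow _ b]
    gcongr
    exact expect_disjointTuples_le hk y r ∅

end Tuples

/-! ### Independence of functions of disjoint coordinates -/

section Factorization

variable {ι G : Type*} [Fintype ι] [DecidableEq ι] [Fintype G] [Nonempty G]

theorem expect_mul_of_dependsOn {S T : Finset ι} (hST : Disjoint S T) {f g : (ι → G) → ℝ}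
    (hf : DependsOn f S) (hg : DependsOn g T) :
    𝔼 a, f a * g a = (𝔼 a, f a) * 𝔼 a, g a := by
  -- Exchanging the `S`-coordinates of two independent copies preserves their joint law and brings
  -- `f` and `g` onto a single copy.
  have swap : Function.Involutive
      fun p : (ι → G) × (ι → G) => (S.piecewise p.1 p.2, S.piecewise p.2 p.1) := by
    rintro ⟨a, b⟩
    ext i <;> by_cases h : i ∈ S <;> simp [h]
  have h1 : ∀ a b, f (S.piecewise a b) = f a := fun a b =>
    hf fun i hi => by simp [mem_coe.1 hi]
  have h2 : ∀ a b, g (S.piecewise a b) = g b := fun a b =>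
    hg fun i hi => by simp [disjoint_right.1 hST (mem_coe.1 hi)]
  symm
  calc (𝔼 a, f a) * 𝔼 b, g b = 𝔼 p : (ι → G) × (ι → G), f p.1 * g p.2 := by
        rw [expect_mul_expect, ← univ_product_univ, expect_product]
    _ = 𝔼 p : (ι → G) × (ι → G), f p.1 * g p.1 := by
        refine Fintype.expect_equiv swap.toPerm _ _ fun p => ?_
        change _ = f (S.piecewise p.1 p.2) * g (S.piecewise p.1 p.2)
        rw [h1, h2]
    _ = 𝔼 a, f a * g a := by
        rw [← univ_product_univ, expect_product]
        exact expect_congr rfl fun a _ => expect_const univ_nonempty (f a * g a)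

theorem expect_prod_of_dependsOn {β : Type*} (s : Finset β) (B : β → Finset ι)
    (hB : Pairwise fun b c => Disjoint (B b) (B c)) (f : β → (ι → G) → ℝ)
    (hf : ∀ b, DependsOn (f b) (B b)) :
    𝔼 a, ∏ b ∈ s, f b a = ∏ b ∈ s, 𝔼 a, f b a := by
  classical
  induction s using Finset.induction_on with
  | empty => simp
  | insert b s hb ih =>
    simp only [prod_insert hb]
    rw [← ih]
    refine expect_mul_of_dependsOn (T := s.biUnion B) ?_ (hf b) ?_
    · rw [disjoint_biUnion_right]
      exact fun c hc => hB fun h => hb (h ▸ hc)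
    · intro x z h
      refine prod_congr rfl fun c hc => hf c fun i hi => h i ?_
      exact mem_coe.2 (mem_biUnion.2 ⟨c, hc, hi⟩)

end Factorization

/-! ### Lower tail by averaging over disjoint blocks -/

section LowerTail

/-- Follows from `exp u ≥ 1 + u + u²/2` and `(1 + u²/2)² - u² = 1 + u⁴/4 ≥ 1`. -/
theorem exp_neg_le_quadratic {u : ℝ} (hu : 0 ≤ u) : Real.exp (-u) ≤ 1 - u + u ^ 2 / 2 := by
  have h := Real.quadratic_le_exp_of_nonneg hu
  rw [Real.exp_neg, inv_le_comm₀ (Real.exp_pos _) (by nlinarith [sq_nonneg (u - 1)])]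
  refine le_trans ?_ h
  rw [inv_le_iff_one_le_mul₀' (by nlinarith [sq_nonneg (u - 1)])]
  nlinarith [sq_nonneg (u ^ 2)]

theorem exists_perm_map_eq {ι : Type*} [Fintype ι] [DecidableEq ι] {I J : Finset ι}
    (h : I.card = J.card) : ∃ τ : Equiv.Perm ι, I.map τ.toEmbedding = J := by
  have e : {x // x ∈ I} ≃ {x // x ∈ J} := Fintype.equivOfCardEq (by simpa using h)
  refine ⟨e.extendSubtype, eq_of_subset_of_card_le (fun j hj => ?_) (by simp [h])⟩
  obtain ⟨i, hi, rfl⟩ := mem_map.1 hj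
  exact e.extendSubtype_mem i hi

/-- Permutations act transitively on sets of a given size, so a random image of `J` is uniform among
them. -/
theorem expect_perm_map {ι : Type*} [Fintype ι] [DecidableEq ι] (φ : Finset ι → ℝ) (J : Finset ι) :
    𝔼 σ : Equiv.Perm ι, φ (J.map σ.toEmbedding) = 𝔼 I ∈ univ.powersetCard J.card, φ I := by
  have hne : ((univ : Finset ι).powersetCard J.card).Nonempty := ⟨J, by simp⟩
  have hinv : ∀ I ∈ (univ : Finset ι).powersetCard J.card,
      𝔼 σ : Equiv.Perm ι, φ (I.map σ.toEmbedding) = 𝔼 σ : Equiv.Perm ι, φ (J.map σ.toEmbedding) := by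
    intro I hI
    obtain ⟨τ, rfl⟩ := exists_perm_map_eq (mem_powersetCard.1 hI).2.symm
    refine Fintype.expect_equiv (Equiv.mulRight τ) _ _ fun σ => ?_
    rw [map_map]
    rfl
  have hsum : ∀ σ : Equiv.Perm ι, 𝔼 I ∈ univ.powersetCard J.card, φ (I.map σ.toEmbedding)
      = 𝔼 I ∈ univ.powersetCard J.card, φ I := by
    intro σ
    refine expect_bij (fun I _ => I.map σ.toEmbedding) (fun I hI => ?_) (fun _ _ => rfl)
      (fun I _ I' _ h => map_injective _ h) fun I hI => ?_
    · simpa using hI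
    · exact ⟨I.map σ.symm.toEmbedding, by simpa using hI, by ext; simp⟩
  rw [← expect_const hne (𝔼 σ : Equiv.Perm ι, φ (J.map σ.toEmbedding)),
    ← expect_congr rfl hinv, expect_comm, expect_congr rfl fun σ _ => hsum σ,
    expect_const univ_nonempty]

variable {ι G : Type*} [AddCommGroup G] [Fintype ι] [DecidableEq ι]

theorem expect_perm_hitCount (B : Finset ι) (k : ℕ) (y : G) (a : ι → G) :
    𝔼 σ : Equiv.Perm ι, hitCount (B.map σ.toEmbedding) k y a
      = B.card.choose k / (Fintype.card ι).choose k * hitCount univ k y a := by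
  have : ∀ σ : Equiv.Perm ι, hitCount (B.map σ.toEmbedding) k y a
      = ∑ I ∈ B.powersetCard k, hitIndicator (I.map σ.toEmbedding) y a := by
    intro σ
    rw [hitCount, powersetCard_map, sum_map]
    rfl
  simp only [this]
  rw [expect_sum_comm]
  have h : ∀ I ∈ B.powersetCard k, 𝔼 σ : Equiv.Perm ι, hitIndicator (I.map σ.toEmbedding) y a
      = hitCount univ k y a / (Fintype.card ι).choose k := by
    intro I hI
    rw [expect_perm_map fun I => hitIndicator I y a, (mem_powersetCard.1 hI).2,
      expect_eq_sum_div_card, card_powersetCard, card_univ, hitCount]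
  rw [sum_congr rfl h, sum_const, card_powersetCard, nsmul_eq_mul]
  ring

variable [Fintype G]

theorem expect_exp_neg_hitCount_le (B : Finset ι) {k : ℕ} (hk : 1 ≤ k) (y : G) {t μ : ℝ}
    (ht : 0 ≤ t) (hμ : μ = B.card.choose k / Fintype.card G) :
    𝔼 a, Real.exp (-(t * hitCount B k y a)) ≤ Real.exp (-(t * μ) + t ^ 2 * (μ + μ ^ 2) / 2) := by
  calc 𝔼 a, Real.exp (-(t * hitCount B k y a))
      ≤ 𝔼 a, (1 - t * hitCount B k y a + t ^ 2 / 2 * hitCount B k y a ^ 2) :=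
        expect_le_expect fun a _ => (exp_neg_le_quadratic
          (mul_nonneg ht (hitCount_nonneg _ _ _ _))).trans_eq (by ring)
    _ = 1 - t * μ + t ^ 2 / 2 * 𝔼 a, hitCount B k y a ^ 2 := by
        rw [expect_add_distrib, expect_sub_distrib, expect_const univ_nonempty, ← mul_expect,
          ← mul_expect, expect_hitCount B hk, hμ]
    _ ≤ 1 - t * μ + t ^ 2 / 2 * (μ + μ ^ 2) := by
        gcongr
        rw [hμ]
        exact expect_hitCount_sq_le B hk y
    _ ≤ _ := by
        have := Real.add_one_le_exp (-(t * μ) + t ^ 2 * (μ + μ ^ 2) / 2)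
        linarith

/-- Lower tail of the number of solutions, by averaging over the ways of choosing `m` disjoint
blocks of `q` elements each. -/
theorem unifProb_hitCount_lower {k m q : ℕ} (hk : 1 ≤ k) (hkn : k ≤ Fintype.card ι)
    (hmq : m * q ≤ Fintype.card ι) (y : G) {μ : ℝ} (hμ : μ = q.choose k / Fintype.card G) :
    unifProb {a : ι → G | hitCount univ k y a
        < 4 / 5 * ((Fintype.card ι).choose k / Fintype.card G)}
      ≤ Real.exp (-(m * μ / (50 * (1 + μ)))) := by
  obtain ⟨e⟩ : Nonempty (Fin m × Fin q ↪ ι) :=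
    Function.Embedding.nonempty_of_card_le (by simpa using hmq)
  set B : Fin m → Finset ι := fun b => univ.map ((Function.Embedding.sectR b (Fin q)).trans e)
    with hBdef
  have hBc : ∀ b, (B b).card = q := fun b => by simp [hBdef]
  have hBd : Pairwise fun b c => Disjoint (B b) (B c) := by
    intro b c hbc
    rw [disjoint_left]
    intro i hi hi'
    simp only [hBdef, mem_map, mem_univ, true_and, Function.Embedding.trans_apply,
      Function.Embedding.sectR_apply] at hi hi'
    obtain ⟨j, rfl⟩ := hi
    obtain ⟨j', h⟩ := hi'
    exact hbc (congrArg Prod.fst (e.injective h)).symm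
  have hμ0 : 0 ≤ μ := hμ ▸ by positivity
  have hN : (0 : ℝ) < Fintype.card G := by exact_mod_cast Fintype.card_pos
  have hC : (0 : ℝ) < (Fintype.card ι).choose k := by exact_mod_cast Nat.choose_pos hkn
  -- This `t` minimises the final exponent `m * μ * (-t / 5 + t ^ 2 * (1 + μ) / 2)`.
  set t : ℝ := 1 / (5 * (1 + μ)) with ht
  have ht0 : 0 ≤ t := by positivity
  set X : Equiv.Perm ι → (ι → G) → ℝ :=
    fun σ a => ∑ b, hitCount ((B b).map σ.toEmbedding) k y a with hX
  have hmean : ∀ a, 𝔼 σ, X σ a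
      = m * (q.choose k / (Fintype.card ι).choose k * hitCount univ k y a) := by
    intro a
    simp only [hX]
    rw [expect_sum_comm]
    simp only [expect_perm_hitCount, hBc, sum_const, card_univ, Fintype.card_fin, nsmul_eq_mul]
  have hjensen : ∀ a, Real.exp (-(t * 𝔼 σ, X σ a)) ≤ 𝔼 σ, Real.exp (-(t * X σ a)) := by
    intro a
    have hcard : (0 : ℝ) < Fintype.card (Equiv.Perm ι) := by exact_mod_cast Fintype.card_pos
    have := convexOn_exp.map_sum_le (t := (univ : Finset (Equiv.Perm ι)))
      (w := fun _ => 1 / (Fintype.card (Equiv.Perm ι) : ℝ)) (p := fun σ => -(t * X σ a))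
      (fun _ _ => by positivity) (by simp) (fun _ _ => Set.mem_univ _)
    simp only [smul_eq_mul, ← mul_sum] at this
    have havg : ∀ f : Equiv.Perm ι → ℝ,
        𝔼 σ, f σ = 1 / (Fintype.card (Equiv.Perm ι) : ℝ) * ∑ σ, f σ := fun f => by
      rw [Fintype.expect_eq_sum_div_card, one_div_mul_eq_div]
    rw [mul_expect, ← expect_neg_distrib, havg, havg]
    exact this
  have hblock : ∀ σ, 𝔼 a, Real.exp (-(t * X σ a))
      ≤ Real.exp (m * (-(t * μ) + t ^ 2 * (μ + μ ^ 2) / 2)) := by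
    intro σ
    simp only [hX, mul_sum, ← sum_neg_distrib, Real.exp_sum]
    rw [expect_prod_of_dependsOn univ (fun b => (B b).map σ.toEmbedding)
      (fun b c hbc => (disjoint_map _).2 (hBd hbc))]
    · rw [Real.exp_nat_mul]
      refine (prod_le_prod (fun b _ => expect_nonneg fun a _ => (Real.exp_pos _).le) fun b _ =>
        expect_exp_neg_hitCount_le (μ := μ) _ hk y ht0 (by rw [hμ, card_map, hBc])).trans ?_
      simp
    · intro b a a' h
      simp only
      rw [hitCount_congr h]
  have hmarkov := unifProb_le_of_le (s := {a : ι → G | hitCount univ k y a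
        < 4 / 5 * ((Fintype.card ι).choose k / Fintype.card G)})
      (f := fun a => Real.exp (-(t * 𝔼 σ, X σ a))) (Real.exp_pos (-(t * (4 / 5 * (m * μ)))))
      (fun a => (Real.exp_pos _).le) (by
        intro a ha
        refine Real.exp_le_exp.2 (neg_le_neg (mul_le_mul_of_nonneg_left ?_ ht0))
        rw [hmean]
        have ha' : hitCount univ k y a ≤ _ := le_of_lt ha
        calc (m : ℝ) * (q.choose k / (Fintype.card ι).choose k * hitCount univ k y a)
            ≤ m * (q.choose k / (Fintype.card ι).choose k *
              (4 / 5 * ((Fintype.card ι).choose k / Fintype.card G))) := by gcongr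
          _ = 4 / 5 * (m * μ) := by rw [hμ]; field_simp)
  refine hmarkov.trans ?_
  rw [div_le_iff₀ (Real.exp_pos _), ← Real.exp_add]
  calc 𝔼 a, Real.exp (-(t * 𝔼 σ, X σ a)) ≤ 𝔼 a, 𝔼 σ, Real.exp (-(t * X σ a)) :=
        expect_le_expect fun a _ => hjensen a
    _ = 𝔼 σ, 𝔼 a, Real.exp (-(t * X σ a)) := expect_comm _ _ _
    _ ≤ 𝔼 _σ : Equiv.Perm ι, Real.exp (m * (-(t * μ) + t ^ 2 * (μ + μ ^ 2) / 2)) :=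
        expect_le_expect fun σ _ => hblock σ
    _ = Real.exp (m * (-(t * μ) + t ^ 2 * (μ + μ ^ 2) / 2)) := expect_const univ_nonempty _
    _ = _ := by
        congr 1
        rw [ht]
        field_simp
        ring

end LowerTail

/-! ### From random variables to uniform counting on `Fin n → G` -/

section Transfer

variable {Ω G : Type*} [Fintype G] [MeasurableSpace G]
  [MeasurableSingletonClass G] [MeasurableSpace Ω] {P : Measure Ω} [IsProbabilityMeasure P]
  {n : ℕ} {x : Fin n → Ω → G}

theorem IsIIDUniform.integral_eq_expect (hx : IsIIDUniform P x) (f : (Fin n → G) → ℝ) :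
    ∫ ω, f (fun i => x i ω) ∂P = 𝔼 a, f a := by
  have hm : Measurable fun ω i => x i ω := measurable_pi_lambda _ hx.measurable
  have : IsProbabilityMeasure (P.map fun ω i => x i ω) :=
    Measure.isProbabilityMeasure_map hm.aemeasurable
  have hpt : ∀ a, (P.map fun ω i => x i ω).real {a} = 1 / Fintype.card (Fin n → G) := by
    intro a
    have hset : (fun ω i => x i ω) ⁻¹' {a} = ⋂ i ∈ univ, x i ⁻¹' {a i} := by
      ext ω
      simp [funext_iff]
    have hi : ∀ i, P (x i ⁻¹' {a i}) = 1 / (Fintype.card G : ENNReal) := by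
      intro i
      rw [← Measure.map_apply (hx.measurable i) (measurableSet_singleton _), hx.uniform i,
        uniformOn_univ]
      simp
    rw [measureReal_def, Measure.map_apply hm (measurableSet_singleton _), hset,
      hx.indep.measure_inter_preimage_eq_mul univ fun i _ => measurableSet_singleton _]
    simp [hi]
  rw [← integral_map (f := f) hm.aemeasurable (Measurable.of_discrete).aestronglyMeasurable,
    integral_fintype (Integrable.of_finite), Fintype.expect_eq_sum_div_card, sum_div]
  refine sum_congr rfl fun a _ => ?_
  rw [hpt, smul_eq_mul]
  ring

theorem IsIIDUniform.measureReal_eq_unifProb (hx : IsIIDUniform P x) (s : Set (Fin n → G)) :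
    P.real {ω | (fun i => x i ω) ∈ s} = unifProb s := by
  have hm : Measurable fun ω i => x i ω := measurable_pi_lambda _ hx.measurable
  rw [unifProb, ← hx.integral_eq_expect, ← integral_indicator_one]
  · rfl
  · exact hm s.toFinite.measurableSet

theorem subsetSumCount_eq_hitCount {G : Type*} [AddCommGroup G] (k : ℕ) (y : G) (a : Fin n → G) :
    subsetSumCount k y a = hitCount univ k y a := by
  classical
  rw [subsetSumCount, subsetSumFamily, hitCount, card_eq_sum_ones, sum_filter]
  push_cast
  refine sum_congr rfl fun I _ => ?_
  by_cases h : ∑ i ∈ I, a i = y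
  · simp [h, hitIndicator_of_eq h]
  · simp [h, hitIndicator_of_ne h]

end Transfer

/-! ### Simultaneous bounds for the counts of smaller sets -/

section Degrees

variable {ι G : Type*} [AddCommGroup G] [Fintype ι] [DecidableEq ι] [Fintype G]

/-- Induction on `j`: the bound at `j` is the degree bound for the tuple estimate at `j + 1`, used
with `r = b = l` and a union bound over targets. -/
theorem unifProb_exists_hitCount_gt_le {K l : ℕ} (hl : K + 1 ≤ l) {p : ℝ}
    (hp : ∀ j, 1 ≤ j → j ≤ K → ((Fintype.card ι).choose j / Fintype.card G / l : ℝ) ≤ p) {j : ℕ}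
    (hj : j ≤ K) :
    unifProb {a : ι → G | ∃ z, (l : ℝ) ^ (2 * j) < hitCount univ j z a}
      ≤ j * (Fintype.card G * p ^ l) := by
  have hl1 : (1 : ℝ) ≤ l := by exact_mod_cast (by omega : 1 ≤ l)
  induction j with
  | zero =>
    have : {a : ι → G | ∃ z, (l : ℝ) ^ (2 * 0) < hitCount univ 0 z a} = ∅ := by
      refine Set.eq_empty_of_forall_notMem ?_
      rintro a ⟨z, hz⟩
      exact absurd (hitCount_zero_le_one univ z a) (not_le.2 (by simpa using hz))
    rw [this, unifProb_empty]
    simp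
  | succ j ih =>
    have hstep : ∀ z, unifProb {a : ι → G | (∀ z', hitCount univ (j + 1 - 1) z' a ≤ (l : ℝ) ^ (2 * j)) ∧
        (l : ℝ) + l * (j + 1 : ℕ) * (l : ℝ) ^ (2 * j) ≤ hitCount univ (j + 1) z a} ≤ p ^ l := by
      intro z
      refine (unifProb_le_of_hitCount_large (Nat.le_add_left 1 j) z (by linarith)
        (by positivity) l).trans ?_
      exact pow_le_pow_left₀ (by positivity) (hp _ (Nat.le_add_left 1 j) hj) _
    have hsub : {a : ι → G | ∃ z, (l : ℝ) ^ (2 * (j + 1)) < hitCount univ (j + 1) z a}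
        ⊆ {a : ι → G | ∃ z, (l : ℝ) ^ (2 * j) < hitCount univ j z a} ∪
          ⋃ z, {a : ι → G | (∀ z', hitCount univ (j + 1 - 1) z' a ≤ (l : ℝ) ^ (2 * j)) ∧
            (l : ℝ) + l * (j + 1 : ℕ) * (l : ℝ) ^ (2 * j) ≤ hitCount univ (j + 1) z a} := by
      rintro a ⟨z, hz⟩
      by_cases h : ∃ z, (l : ℝ) ^ (2 * j) < hitCount univ j z a
      · exact Or.inl h
      · push Not at h
        -- The threshold grows by `l ^ 2` per step because `j + 2 ≤ l`.
        refine Or.inr (Set.mem_iUnion.2 ⟨z, h, le_trans ?_ hz.le⟩)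
        have h1 : (1 : ℝ) ≤ (l : ℝ) ^ (2 * j) := one_le_pow₀ hl1
        have h2 : ((j + 1 : ℕ) : ℝ) + 1 ≤ l := by exact_mod_cast (by omega : j + 1 + 1 ≤ l)
        calc (l : ℝ) + l * (j + 1 : ℕ) * (l : ℝ) ^ (2 * j)
            ≤ l * (l : ℝ) ^ (2 * j) + l * (j + 1 : ℕ) * (l : ℝ) ^ (2 * j) := by
              gcongr
              exact le_mul_of_one_le_right (by positivity) h1
          _ = l * ((j + 1 : ℕ) + 1) * (l : ℝ) ^ (2 * j) := by ring
          _ ≤ l * l * (l : ℝ) ^ (2 * j) := by gcongr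
          _ = (l : ℝ) ^ (2 * (j + 1)) := by ring
    refine (unifProb_mono hsub).trans ((unifProb_union_le _ _).trans ?_)
    have h1 := ih (by omega)
    have h2 := unifProb_iUnion_le _ hstep
    push_cast at h2 ⊢
    linarith

end Degrees

/-! ### Numerical consequences of the hypotheses -/

section Parameters

theorem choose_le_choose_of_le_half {n i j : ℕ} (hij : i ≤ j) (hj : 2 * j ≤ n) :
    n.choose i ≤ n.choose j := by
  induction j, hij using Nat.le_induction with
  | base => rfl
  | succ j _ ih =>
    exact (ih (by omega)).trans (Nat.choose_le_succ_of_lt_half_left (by omega))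

theorem choose_mul_pow_le {n q k : ℕ} {c : ℝ} (hc : 0 ≤ c)
    (h : (n : ℝ) ≤ c * (q + 1 - k : ℕ)) : (n.choose k : ℝ) ≤ c ^ k * q.choose k := by
  have h1 : (n.choose k : ℝ) ≤ (n : ℝ) ^ k / k.factorial := Nat.choose_le_pow_div k n
  have h2 : ((q + 1 - k : ℕ) : ℝ) ^ k / k.factorial ≤ q.choose k := Nat.pow_le_choose k q
  calc (n.choose k : ℝ) ≤ (n : ℝ) ^ k / k.factorial := h1
    _ ≤ (c * (q + 1 - k : ℕ)) ^ k / k.factorial := by gcongr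
    _ = c ^ k * (((q + 1 - k : ℕ) : ℝ) ^ k / k.factorial) := by rw [mul_pow]; ring
    _ ≤ c ^ k * q.choose k := by gcongr

theorem fifty_le_of_sq_le_two_pow {l : ℕ} (hl : 2 ≤ l) (h : (141824 * l ^ 3) ^ 2 ≤ 2 ^ l) :
    50 ≤ l := by
  by_contra! hlt
  interval_cases l <;> omega

variable {N n k l : ℕ}

theorem sq_le_two_pow_of_logb (hN : 1 ≤ N) (hlog : 2 * Real.logb 2 (N : ℝ) ≤ (l : ℝ)) :
    N ^ 2 ≤ 2 ^ l := by
  have hN' : (0 : ℝ) < N := by exact_mod_cast hN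
  have h : Real.logb 2 ((N : ℝ) ^ 2) ≤ l := by
    rw [Real.logb_pow]
    exact_mod_cast hlog
  rw [Real.logb_le_iff_le_rpow (by norm_num) (by positivity), Real.rpow_natCast] at h
  exact_mod_cast h

/-- Divides the two binomial bounds, using `k * n.choose k ≤ n * n.choose (k - 1)`. -/
theorem mul_pow_le_of_choose_bounds (hN : 1 ≤ N) (hk : 1 ≤ k) (hl : 1 ≤ l)
    (ha : 554 * ((k : ℝ) * N * (l : ℝ) ^ (2 * k + 1)) ≤ n.choose k)
    (hb : (n.choose (k - 1) : ℝ) ≤ (l : ℝ) * N / (k * 2 ^ k)) :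
    554 * ((k : ℝ) ^ 3 * 2 ^ k * (l : ℝ) ^ (2 * k)) ≤ n := by
  have hN' : (0 : ℝ) < N := by exact_mod_cast hN
  have hk' : (0 : ℝ) < k := by exact_mod_cast hk
  have hl' : (0 : ℝ) < l := by exact_mod_cast hl
  have hrec : (n.choose k : ℝ) * k ≤ n.choose (k - 1) * n := by
    obtain ⟨k, rfl⟩ : ∃ j, k = j + 1 := ⟨k - 1, by omega⟩
    have := Nat.choose_succ_right_eq n k
    have h2 : n.choose k * (n - k) ≤ n.choose k * n := Nat.mul_le_mul_left _ (Nat.sub_le _ _)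
    rw [← this] at h2
    exact_mod_cast h2
  have h : 554 * ((k : ℝ) * N * (l : ℝ) ^ (2 * k + 1)) * k ≤ l * N / (k * 2 ^ k) * n :=
    (mul_le_mul_of_nonneg_right ha hk'.le).trans (hrec.trans (by gcongr))
  rw [div_mul_eq_mul_div, le_div_iff₀ (by positivity)] at h
  refine le_of_mul_le_mul_left ?_ (mul_pos hl' hN')
  calc _ = 554 * ((k : ℝ) * N * (l : ℝ) ^ (2 * k + 1)) * k * (k * 2 ^ k) := by ring
    _ ≤ _ := h

theorem two_le_of_choose_bound (hN : 1 ≤ N) (hk : 1 ≤ k) (hl : 1 ≤ l) (hNl : N ^ 2 ≤ 2 ^ l)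
    (hn : k ≤ n) (hb : (n.choose (k - 1) : ℝ) ≤ (l : ℝ) * N / (k * 2 ^ k)) : 2 ≤ l := by
  have hk' : (1 : ℝ) ≤ k := by exact_mod_cast hk
  by_contra! hlt
  obtain rfl : l = 1 := by omega
  obtain rfl : N = 1 := by nlinarith
  have h1 : (1 : ℝ) ≤ n.choose (k - 1) := by
    exact_mod_cast Nat.choose_pos (by omega : k - 1 ≤ n)
  have h2 : (2 : ℝ) ≤ 2 ^ k := by simpa using pow_le_pow_right₀ (by norm_num : (1 : ℝ) ≤ 2) hk
  have h3 := h1.trans hb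
  rw [le_div_iff₀ (by positivity)] at h3
  norm_num at h3
  nlinarith

/-- For `k ≥ 2`, `n ≤ n.choose (k - 1)`, so the bounds force `N` to be at least `554 k⁴ 4^k
l^(2k-1)`; then `N ^ 2 ≤ 2 ^ l` makes `l` large. -/
theorem large_of_choose_bounds (hk : 2 ≤ k) (hl : 2 ≤ l) (hNl : N ^ 2 ≤ 2 ^ l)
    (hn : 554 * ((k : ℝ) ^ 3 * 2 ^ k * (l : ℝ) ^ (2 * k)) ≤ n) (hkn : 2 * k ≤ n)
    (hb : (n.choose (k - 1) : ℝ) ≤ (l : ℝ) * N / (k * 2 ^ k)) : 4 * k ≤ l ∧ 50 ≤ l := by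
  have hl' : (0 : ℝ) < l := by exact_mod_cast (by omega : 0 < l)
  have hk' : (0 : ℝ) < k := by exact_mod_cast (by omega : 0 < k)
  have hnc : (n : ℝ) ≤ n.choose (k - 1) := by
    have := choose_le_choose_of_le_half (n := n) (by omega : 1 ≤ k - 1) (by omega)
    rw [Nat.choose_one_right] at this
    exact_mod_cast this
  have h := hn.trans (hnc.trans hb)
  rw [le_div_iff₀ (by positivity)] at h
  have hnat : 554 * (k ^ 3 * 2 ^ k * l ^ (2 * k)) * (k * 2 ^ k) ≤ l * N := by exact_mod_cast h
  have h4 : 4 ^ k = 2 ^ k * 2 ^ k := by rw [← mul_pow]; norm_num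
  have hpow : l ^ (2 * k) = l * (l ^ 3 * l ^ (2 * k - 4)) := by
    rw [← pow_add, ← pow_succ']
    congr 1
    omega
  have hmain : 554 * (k ^ 4 * 4 ^ k) * (l ^ 3 * l ^ (2 * k - 4)) ≤ N := by
    refine Nat.le_of_mul_le_mul_left ?_ (by omega : 0 < l)
    calc _ = 554 * (k ^ 3 * 2 ^ k * l ^ (2 * k)) * (k * 2 ^ k) := by rw [hpow, h4]; ring
      _ ≤ _ := hnat
  have hl1 : 1 ≤ l ^ (2 * k - 4) := Nat.one_le_pow _ _ (by omega)
  have hk4 : 16 ≤ k ^ 4 := Nat.pow_le_pow_left hk 4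
  have hk4' : 16 ≤ 4 ^ k := Nat.pow_le_pow_right (by norm_num : 0 < 4) hk
  have hl3 : 1 ≤ l ^ 3 := Nat.one_le_pow _ _ (by omega)
  constructor
  · have h1 : 4 ^ k ≤ N := by
      refine le_trans ?_ hmain
      calc 4 ^ k = 1 * (1 * 4 ^ k) * (1 * 1) := by ring
        _ ≤ 554 * (k ^ 4 * 4 ^ k) * (l ^ 3 * l ^ (2 * k - 4)) := by gcongr <;> omega
    have h2 : 2 ^ (4 * k) ≤ 2 ^ l := by
      calc 2 ^ (4 * k) = (4 ^ k) ^ 2 := by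
            rw [← pow_mul, mul_comm k 2, pow_mul, pow_mul]
            norm_num
        _ ≤ N ^ 2 := Nat.pow_le_pow_left h1 2
        _ ≤ 2 ^ l := hNl
    exact (Nat.pow_le_pow_iff_right (by norm_num)).1 h2
  · refine fifty_le_of_sq_le_two_pow hl (le_trans (Nat.pow_le_pow_left ?_ 2) hNl)
    refine le_trans ?_ hmain
    calc 141824 * l ^ 3 = 554 * (16 * 16) * (l ^ 3 * 1) := by ring
      _ ≤ 554 * (k ^ 4 * 4 ^ k) * (l ^ 3 * l ^ (2 * k - 4)) := by gcongr

end Parameters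

/-! ### The three tail bounds and their combination -/

section Tails

variable {G : Type*} [AddCommGroup G] [Fintype G] {n k l : ℕ}

theorem unifProb_hitCount_lower_le_half_pow (hk : 1 ≤ k) (hl : 2 ≤ l) (hkl : k = 1 ∨ 50 ≤ l)
    (hn : 200 * l * k ≤ n)
    (ha : 554 * ((k : ℝ) * Fintype.card G * (l : ℝ) ^ (2 * k + 1)) ≤ n.choose k) (y : G) :
    unifProb {a : Fin n → G | hitCount univ k y a < 4 / 5 * (n.choose k / Fintype.card G)}
      ≤ (1 / 2) ^ l := by
  have hN : (0 : ℝ) < Fintype.card G := by exact_mod_cast Fintype.card_pos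
  have hl' : (2 : ℝ) ≤ l := by exact_mod_cast hl
  have hkn : k ≤ n := by nlinarith
  -- With `40 * l` blocks of mean `μ ≥ 44`, the exponent `40 l μ / (50 (1 + μ))` exceeds `l * log
  -- 2`.
  set q := n / (40 * l) with hq
  set μ : ℝ := q.choose k / Fintype.card G with hμ
  have hqk : 5 * k ≤ q := by
    rw [hq, Nat.le_div_iff_mul_le (by omega)]
    linarith
  have hnq : (n : ℝ) ≤ 50 * l * (q + 1 - k : ℕ) := by
    have h1 : n < 40 * l * (q + 1) := Nat.lt_mul_div_succ n (by omega)
    have h1' : (n : ℝ) < 40 * l * (q + 1) := by exact_mod_cast h1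
    have hn' : (200 : ℝ) * l * k ≤ n := by exact_mod_cast hn
    rw [Nat.cast_sub (by omega)]
    push_cast
    linarith
  have hpow : 44 * (50 * (l : ℝ)) ^ k ≤ 554 * (k * (l : ℝ) ^ (2 * k + 1)) := by
    have hk' : (1 : ℝ) ≤ k := by exact_mod_cast hk
    -- For `k = 1`, `l = 2` only just suffices: `2200 ≤ 2216`. Otherwise `50 ≤ l` absorbs the powers
    -- of 50.
    have h : 44 * (50 : ℝ) ^ k ≤ 554 * (k * (l : ℝ) ^ (k + 1)) := by
      rcases hkl with rfl | hl50
      · norm_num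
        nlinarith
      · have hl50' : (50 : ℝ) ≤ l := by exact_mod_cast hl50
        calc 44 * (50 : ℝ) ^ k ≤ 554 * (1 * (50 : ℝ) ^ (k + 1)) := by
              rw [pow_succ]
              nlinarith [pow_pos (by norm_num : (0 : ℝ) < 50) k]
          _ ≤ 554 * (k * (l : ℝ) ^ (k + 1)) := by gcongr
    calc 44 * (50 * (l : ℝ)) ^ k = 44 * (50 : ℝ) ^ k * (l : ℝ) ^ k := by rw [mul_pow]; ring
      _ ≤ 554 * (k * (l : ℝ) ^ (k + 1)) * (l : ℝ) ^ k := by gcongr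
      _ = 554 * (k * (l : ℝ) ^ (2 * k + 1)) := by ring
  have hμ44 : 44 ≤ μ := by
    rw [hμ, le_div_iff₀ hN]
    have h := ha.trans (choose_mul_pow_le (by positivity) hnq)
    refine le_of_mul_le_mul_left ?_ (by positivity : (0 : ℝ) < (50 * l) ^ k)
    calc (50 * (l : ℝ)) ^ k * (44 * Fintype.card G)
        = 44 * (50 * (l : ℝ)) ^ k * Fintype.card G := by ring
      _ ≤ 554 * (k * (l : ℝ) ^ (2 * k + 1)) * Fintype.card G := by gcongr
      _ = 554 * ((k : ℝ) * Fintype.card G * (l : ℝ) ^ (2 * k + 1)) := by ring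
      _ ≤ _ := h
  have key := unifProb_hitCount_lower (ι := Fin n) (m := 40 * l) hk (by simpa using hkn)
    (by simpa using Nat.mul_div_le n (40 * l)) y hμ
  rw [Fintype.card_fin] at key
  refine key.trans ?_
  have hlog := Real.log_two_lt_d9
  have hexp : (l : ℝ) * Real.log 2 ≤ (40 * l : ℕ) * μ / (50 * (1 + μ)) := by
    rw [le_div_iff₀ (by positivity)]
    push_cast
    have : Real.log 2 * (50 * (1 + μ)) ≤ 40 * μ := by nlinarith
    calc (l : ℝ) * Real.log 2 * (50 * (1 + μ)) = l * (Real.log 2 * (50 * (1 + μ))) := by ring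
      _ ≤ l * (40 * μ) := by gcongr
      _ = _ := by ring
  calc _ ≤ Real.exp (-(l * Real.log 2)) := Real.exp_le_exp.2 (neg_le_neg hexp)
    _ = (1 / 2) ^ l := by
      rw [Real.exp_neg, Real.exp_nat_mul, Real.exp_log two_pos, ← inv_pow, one_div]

theorem unifProb_degree_le_half_pow (hk : 1 ≤ k) (hl : 2 ≤ l) (hkl : k = 1 ∨ 4 * k ≤ l)
    (hn : 2 * k ≤ n) (hNl : Fintype.card G ^ 2 ≤ 2 ^ l)
    (hb : (n.choose (k - 1) : ℝ) ≤ (l : ℝ) * Fintype.card G / (k * 2 ^ k)) :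
    unifProb {a : Fin n → G | ∃ z, (l : ℝ) ^ (2 * (k - 1)) < hitCount univ (k - 1) z a}
      ≤ (1 / 2) ^ l := by
  have hN : (0 : ℝ) < Fintype.card G := by exact_mod_cast Fintype.card_pos
  have hl' : (2 : ℝ) ≤ l := by exact_mod_cast hl
  have hk' : (1 : ℝ) ≤ k := by exact_mod_cast hk
  -- The value of `p` is the bound on `n.choose (k - 1)` divided by `N * l`; smaller `j` obey it by
  -- monotonicity below `n / 2`.
  have key := unifProb_exists_hitCount_gt_le (ι := Fin n) (G := G) (K := k - 1) (l := l)
    (by omega) (p := 1 / (k * 2 ^ k)) (fun j _ hj => by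
      have : (n.choose j : ℝ) ≤ n.choose (k - 1) := by
        exact_mod_cast choose_le_choose_of_le_half hj (by omega)
      rw [Fintype.card_fin, div_div, div_le_iff₀ (by positivity)]
      exact (this.trans hb).trans_eq (by ring)) le_rfl
  refine key.trans ?_
  obtain rfl | hk2 := eq_or_lt_of_le hk
  · simp
  have h1 : ((k - 1 : ℕ) : ℝ) ≤ (k : ℝ) ^ l := by
    exact_mod_cast (Nat.sub_le k 1).trans (Nat.le_self_pow (by omega) k)
  have h2 : (Fintype.card G : ℝ) ≤ 2 ^ l := by
    exact_mod_cast (Nat.le_self_pow two_ne_zero _).trans hNl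
  have h3 : (2 : ℝ) ^ 2 ≤ 2 ^ k := pow_le_pow_right₀ (by norm_num) hk2
  calc ((k - 1 : ℕ) : ℝ) * (Fintype.card G * (1 / (k * 2 ^ k)) ^ l)
      ≤ (k : ℝ) ^ l * (2 ^ l * (1 / (k * 2 ^ k)) ^ l) := by gcongr
    _ = (2 / 2 ^ k) ^ l := by
      rw [← mul_pow, ← mul_pow]
      congr 1
      field_simp
    _ ≤ (2 / 2 ^ 2) ^ l := by gcongr
    _ = (1 / 2) ^ l := by norm_num

theorem unifProb_hitCount_upper_le_half_pow (hk : 1 ≤ k) (hl : 2 ≤ l)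
    (ha : 554 * ((k : ℝ) * Fintype.card G * (l : ℝ) ^ (2 * k + 1)) ≤ n.choose k) (y : G) :
    unifProb {a : Fin n → G | (∀ z, hitCount univ (k - 1) z a ≤ (l : ℝ) ^ (2 * (k - 1))) ∧
        6 / 5 * (n.choose k / Fintype.card G) < hitCount univ k y a} ≤ (1 / 2) ^ l := by
  have hN : (0 : ℝ) < Fintype.card G := by exact_mod_cast Fintype.card_pos
  have hl' : (2 : ℝ) ≤ l := by exact_mod_cast hl
  have hk' : (1 : ℝ) ≤ k := by exact_mod_cast hk
  set μ : ℝ := n.choose k / Fintype.card G with hμ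
  have hμl : 554 * (k * (l : ℝ) ^ (2 * k + 1)) ≤ μ := by
    rw [hμ, le_div_iff₀ hN]
    linarith
  have hμ0 : 0 < μ := lt_of_lt_of_le (by positivity) hμl
  have hdeg : ((8 * l : ℕ) : ℝ) * k * (l : ℝ) ^ (2 * (k - 1)) ≤ 1 / 10 * μ := by
    have h1 : (l : ℝ) * (l : ℝ) ^ (2 * (k - 1)) ≤ (l : ℝ) ^ (2 * k + 1) := by
      rw [← pow_succ']
      exact pow_le_pow_right₀ (by linarith) (by omega)
    have h2 := mul_le_mul_of_nonneg_left h1 (by positivity : (0 : ℝ) ≤ k)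
    have h3 : (0 : ℝ) ≤ k * (l : ℝ) ^ (2 * k + 1) := by positivity
    push_cast
    linarith
  -- The excess `μ / 5` is split evenly between the tuple ratio `10 / 11` and the degree loss; `r =
  -- 8 * l` works since `(10 / 11) ^ 8 < 1 / 2`.
  have key := unifProb_le_of_hitCount_large (ι := Fin n) hk y (d := (l : ℝ) ^ (2 * (k - 1)))
    (b := 11 / 10 * μ) (by positivity) (by positivity) (8 * l)
  rw [Fintype.card_fin, ← hμ] at key
  refine (unifProb_mono ?_).trans (key.trans ?_)
  · rintro a ⟨hd, h⟩
    exact ⟨hd, by linarith⟩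
  · rw [show μ / (11 / 10 * μ) = 10 / 11 by field_simp, pow_mul]
    gcongr
    norm_num

theorem unifProb_hitCount_deviation_le (hk : 1 ≤ k) (hl : 1 ≤ l)
    (hNl : Fintype.card G ^ 2 ≤ 2 ^ l)
    (ha : 554 * ((k : ℝ) * Fintype.card G * (l : ℝ) ^ (2 * k + 1)) ≤ n.choose k)
    (hb : (n.choose (k - 1) : ℝ) ≤ (l : ℝ) * Fintype.card G / (k * 2 ^ k)) (y : G) :
    unifProb {a : Fin n → G | |hitCount univ k y a - n.choose k / Fintype.card G|
        > 1 / 5 * (n.choose k / Fintype.card G)} ≤ 3 * (1 / 2) ^ l := by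
  have hN : 1 ≤ Fintype.card G := Fintype.card_pos
  have hk' : (1 : ℝ) ≤ k := by exact_mod_cast hk
  have hl' : (1 : ℝ) ≤ l := by exact_mod_cast hl
  have hkn : k ≤ n := by
    by_contra! h
    rw [Nat.choose_eq_zero_of_lt h] at ha
    have : (0 : ℝ) < 554 * ((k : ℝ) * Fintype.card G * (l : ℝ) ^ (2 * k + 1)) := by positivity
    exact absurd ha (by simpa using this)
  have hl2 := two_le_of_choose_bound hN hk hl hNl hkn hb
  have hn := mul_pow_le_of_choose_bounds hN hk hl ha hb
  have hn200 : 200 * l * k ≤ n := by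
    have h : (200 : ℝ) * l * k ≤ n := by
      refine le_trans ?_ hn
      calc (200 : ℝ) * l * k ≤ 554 * (k * 1 * l) := by
            have : (0 : ℝ) ≤ k * l := by positivity
            linarith
        _ ≤ 554 * ((k : ℝ) ^ 3 * 2 ^ k * (l : ℝ) ^ (2 * k)) := by
            gcongr
            · exact le_self_pow₀ hk' (by norm_num)
            · exact one_le_pow₀ (by norm_num)
            · exact le_self_pow₀ hl' (by omega)
    exact_mod_cast h
  have h2k : 2 * k ≤ n := by nlinarith
  have hlarge : k = 1 ∨ 4 * k ≤ l ∧ 50 ≤ l := by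
    obtain h | h := eq_or_lt_of_le hk
    · exact Or.inl h.symm
    · exact Or.inr (large_of_choose_bounds h hl2 hNl hn h2k hb)
  have hlow := unifProb_hitCount_lower_le_half_pow hk hl2 (hlarge.imp_right And.right) hn200 ha y
  have hdeg := unifProb_degree_le_half_pow hk hl2 (hlarge.imp_right And.left) h2k hNl hb
  have hup := unifProb_hitCount_upper_le_half_pow hk hl2 ha y
  set μ : ℝ := n.choose k / Fintype.card G
  refine (unifProb_mono (t := {a : Fin n → G | hitCount univ k y a < 4 / 5 * μ} ∪
    ({a | ∃ z, (l : ℝ) ^ (2 * (k - 1)) < hitCount univ (k - 1) z a} ∪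
      {a | (∀ z, hitCount univ (k - 1) z a ≤ (l : ℝ) ^ (2 * (k - 1))) ∧
        6 / 5 * μ < hitCount univ k y a})) ?_).trans ?_
  · intro a ha
    obtain h | h := lt_abs.1 (show 1 / 5 * μ < |hitCount univ k y a - μ| from ha)
    · by_cases hz : ∃ z, (l : ℝ) ^ (2 * (k - 1)) < hitCount univ (k - 1) z a
      · exact Or.inr (Or.inl hz)
      · push Not at hz
        exact Or.inr (Or.inr ⟨hz, by linarith⟩)
    · exact Or.inl (show hitCount univ k y a < 4 / 5 * μ by linarith)
  · linarith [unifProb_union_le {a : Fin n → G | hitCount univ k y a < 4 / 5 * μ}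
      ({a | ∃ z, (l : ℝ) ^ (2 * (k - 1)) < hitCount univ (k - 1) z a} ∪
        {a | (∀ z, hitCount univ (k - 1) z a ≤ (l : ℝ) ^ (2 * (k - 1))) ∧
          6 / 5 * μ < hitCount univ k y a}),
      unifProb_union_le
        {a : Fin n → G | ∃ z, (l : ℝ) ^ (2 * (k - 1)) < hitCount univ (k - 1) z a}
        {a | (∀ z, hitCount univ (k - 1) z a ≤ (l : ℝ) ^ (2 * (k - 1))) ∧
          6 / 5 * μ < hitCount univ k y a}]

end Tails

theorem mainTheorem3
    {G : Type*} [AddCommGroup G] [Finite G] [MeasurableSpace G] [MeasurableSingletonClass G]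
    {Ω : Type*} [MeasurableSpace Ω] (P : Measure Ω) [IsProbabilityMeasure P]
    (N n k l : ℕ) (hN : Nat.card G = N) (hk : 1 ≤ k) (hl : 1 ≤ l)
    (x : Fin n → Ω → G) (hx : IsIIDUniform P x) (y : G)
    (hlog : 2 * Real.logb 2 (N : ℝ) ≤ (l : ℝ))
    (ha : 800 * Real.log 2 * ((k : ℝ) * (N : ℝ) * (l : ℝ) ^ (2 * k + 1)) ≤ (n.choose k : ℝ))
    (hb : (n.choose (k - 1) : ℝ) ≤ (l : ℝ) * (N : ℝ) / ((k : ℝ) * 2 ^ k)) :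
    P.real {ω | |subsetSumCount k y (fun i => x i ω)
          - ∫ ω', subsetSumCount k y (fun i => x i ω') ∂P|
        > 1 / 5 * ∫ ω', subsetSumCount k y (fun i => x i ω') ∂P}
      < 5 * (2 : ℝ) ^ (-(l : ℤ)) := by
  have := Fintype.ofFinite G
  rw [Nat.card_eq_fintype_card] at hN
  subst hN
  have hmean : ∫ ω, subsetSumCount k y (fun i => x i ω) ∂P = n.choose k / Fintype.card G := by
    simp only [subsetSumCount_eq_hitCount]
    rw [hx.integral_eq_expect, expect_hitCount univ hk, card_univ, Fintype.card_fin]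
  have ha' : 554 * ((k : ℝ) * Fintype.card G * (l : ℝ) ^ (2 * k + 1)) ≤ n.choose k := by
    refine le_trans ?_ ha
    gcongr
    linarith [Real.log_two_gt_d9]
  rw [hmean]
  simp only [subsetSumCount_eq_hitCount]
  calc _ = unifProb {a : Fin n → G | |hitCount univ k y a - n.choose k / Fintype.card G|
        > 1 / 5 * (n.choose k / Fintype.card G)} := hx.measureReal_eq_unifProb _
    _ ≤ 3 * (1 / 2) ^ l :=
        unifProb_hitCount_deviation_le hk hl (sq_le_two_pow_of_logb Fintype.card_pos hlog) ha' hb y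
    _ < 5 * (1 / 2) ^ l := by
        have : (0 : ℝ) < (1 / 2) ^ l := by positivity
        linarith
    _ = 5 * (2 : ℝ) ^ (-(l : ℤ)) := by
        rw [zpow_neg, zpow_natCast, one_div, inv_pow]
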